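/- A context-free grammar has a finite alphabet of letters, a finite set of non-terminals, a finite set of rules $N\to X$ (with $X$ a finite sequence of letters and non-terminals) and an axiom $S$; $\mathcal L(G)$ is its language and $\mathcal L(G)_n$ the finite set of words of length $n$ in $\mathcal L(G)$. The grammar is unambiguous if every word $w\in\mathcal L(G)$ has exactly one parse tree $d_w$. It is in binary Chomsky normal form if each of its rules has one of the forms $S\to\varepsilon$; $S\to N$; $N\to N'$ (an alternative of a union) or $N\to N'N''$ (a product) with $N,N',N''\ne S$; or $N\to t$ with $t$ a letter. A rule-weighted grammar is a context-free grammar with a weight $\lambda(r)>0$ for each rule $r$; if it is unambiguous, the weight of $w\in\mathcal L(G)$ is $\lambda(w)=\prod_{r\in d_w}\lambda(r)$, the product over the internal nodes of $d_w$ of the weights of the rules labelling them. A terminal-weighted grammar is a context-free grammar with a weight $\pi_t>0$ for each letter $t$; the weight of a word $w$ is $\pi(w)=\prod_t\pi_t^{|w|_t}$, where $|w|_t$ is the number of occurrences of $t$ in $w$. In both cases the probability of $w\in\mathcal L(G)_n$ is its weight divided by the sum of the weights of all words in $\mathcal L(G)_n$. Theorem. Let $G$ be an unambiguous rule-weighted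 grammar in binary Chomsky normal form over a finite alphabet $\Sigma$. Then there are a finite alphabet $\Sigma'$, a map $\rho:\Sigma'\to\Sigma$ (each letter of $\Sigma'$ is a copy of a letter of $\Sigma$) and an unambiguous terminal-weighted grammar $H$ over $\Sigma'$ such that the letter-by-letter relabelling $\rho^*:t_1\cdots t_n\mapsto\rho(t_1)\cdots\rho(t_n)$ restricts to a bijection from $\mathcal L(H)$ onto $\mathcal L(G)$ and, for every $n\ge 0$ and every $w\in\mathcal L(H)_n$, $$\mathbb P_H(w)=\mathbb P_G(\rho^*(w)).$$ -/

import Mathlib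

universe u

namespace ContextFreeGrammar

variable {T : Type u}

/-- The ordered forests of derivations of a sentential form `s` in the grammar `g`: the trees of the
forest are, from left to right, one per symbol of `s`. A terminal symbol is a leaf; a nonterminal
`A` is an internal node labelled by a rule `A → α` of `g`, whose children form a forest for `α`. -/
inductive ParseForest (g : ContextFreeGrammar T) : List (Symbol T g.NT) → Type u
  /-- The empty forest. -/
  | nil : ParseForest g []
  /-- A forest whose first tree is the leaf `t`. -/
  | leaf (t : T) {s : List (Symbol T g.NT)} (rest : ParseForest g s) :
      ParseForest g (Symbol.terminal t :: s)
  /-- A forest whose first tree has a root labelled by the rule `A → α`. -/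
  | node (A : g.NT) (α : List (Symbol T g.NT)) (h : ⟨A, α⟩ ∈ g.rules) {s : List (Symbol T g.NT)}
      (children : ParseForest g α) (rest : ParseForest g s) :
      ParseForest g (Symbol.nonterminal A :: s)

/-- A parse tree: its root derives the axiom. -/
abbrev ParseTree (g : ContextFreeGrammar T) : Type u :=
  ParseForest g [Symbol.nonterminal g.initial]

/-- The word read on the leaves, from left to right. -/
def ParseForest.yield {g : ContextFreeGrammar T} :
    {s : List (Symbol T g.NT)} → ParseForest g s → List T
  | _, .nil => []
  | _, .leaf t rest => t :: rest.yield
  | _, .node _ _ _ children rest => children.yield ++ rest.yield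

/-- Every generated word has exactly one parse tree. -/
def Unambiguous (g : ContextFreeGrammar T) : Prop :=
  ∀ w ∈ g.language, ∃! d : g.ParseTree, d.yield = w

/-- Binary variant of the Chomsky normal form: with `S` the axiom, every rule has one of the forms
`S → ε`, `S → N`, and `N → N'`, `N → N' N''` with `N, N', N'' ≠ S` (a union `N → N' | N''` being
the two rules `N → N'` and `N → N''`), and `N → t` with `t` a letter. -/
def IsBinaryCNF (g : ContextFreeGrammar T) : Prop :=
  ∀ r ∈ g.rules,
    (r.input = g.initial ∧ r.output = []) ∨
    (r.input = g.initial ∧ ∃ B : g.NT, r.output = [Symbol.nonterminal B]) ∨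
    (r.input ≠ g.initial ∧ ∃ B : g.NT, B ≠ g.initial ∧ r.output = [Symbol.nonterminal B]) ∨
    (r.input ≠ g.initial ∧ ∃ B C : g.NT, B ≠ g.initial ∧ C ≠ g.initial ∧
      r.output = [Symbol.nonterminal B, Symbol.nonterminal C]) ∨
    (∃ t : T, r.output = [Symbol.terminal t])

/-- The finite set of all words of length `n` generated by `g`. -/
noncomputable def wordsOfLength [Finite T] (g : ContextFreeGrammar T) (n : ℕ) : Finset (List T) :=
  ((List.finite_length_eq T n).subset
    (fun _ hw => hw.2 : {w : List T | w ∈ g.language ∧ w.length = n} ⊆ _)).toFinset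

theorem mem_wordsOfLength [Finite T] {g : ContextFreeGrammar T} {n : ℕ} {w : List T} :
    w ∈ g.wordsOfLength n ↔ w ∈ g.language ∧ w.length = n := by
  simp [wordsOfLength]

end ContextFreeGrammar

/-- A context-free grammar with finitely many nonterminals and a positive weight on each letter. -/
structure TerminalWeightedGrammar (T : Type u) extends ContextFreeGrammar T where
  finite_NT : Finite NT
  /-- The terminal-weighting function. -/
  weight : T → ℝ
  weight_pos : ∀ t, 0 < weight t

namespace TerminalWeightedGrammar

variable {T : Type u}

/-- The weight of a word: the product of the weights of its letters, with multiplicity. -/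
def wordWeight (G : TerminalWeightedGrammar T) (w : List T) : ℝ :=
  (w.map G.weight).prod

theorem wordWeight_eq_prod_pow_count [Fintype T] [DecidableEq T] (G : TerminalWeightedGrammar T)
    (w : List T) : G.wordWeight w = ∏ t : T, G.weight t ^ w.count t := by
  unfold wordWeight
  rw [Finset.prod_list_map_count]
  refine Finset.prod_subset (Finset.subset_univ _) fun t _ ht => ?_
  rw [List.count_eq_zero_of_not_mem (by simpa using ht), pow_zero]

/-- The probability of `w` among the generated words of length `n` (for `w` one of these). -/
noncomputable def prob [Finite T] (G : TerminalWeightedGrammar T) (n : ℕ) (w : List T) : ℝ :=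
  G.wordWeight w / ∑ v ∈ G.wordsOfLength n, G.wordWeight v

end TerminalWeightedGrammar

/-- A context-free grammar with finitely many nonterminals and a positive weight on each rule. -/
structure RuleWeightedGrammar (T : Type u) extends ContextFreeGrammar T where
  finite_NT : Finite NT
  /-- The rule-weighting function. -/
  weight : {r : ContextFreeRule T NT // r ∈ rules} → ℝ
  weight_pos : ∀ r, 0 < weight r

namespace RuleWeightedGrammar

variable {T : Type u}

/-- The product of the weights of the rules labelling the internal nodes, with multiplicity. -/
def forestWeight (G : RuleWeightedGrammar T) :
    {s : List (Symbol T G.NT)} → G.ParseForest s → ℝ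
  | _, .nil => 1
  | _, .leaf _ rest => G.forestWeight rest
  | _, .node A α h children rest =>
      G.weight ⟨⟨A, α⟩, h⟩ * G.forestWeight children * G.forestWeight rest

open Classical in
/-- The weight of a generated word: the weight of its parse tree, which is unique in an unambiguous
grammar (and, by convention, `0` for a word that has no parse tree). -/
noncomputable def wordWeight (G : RuleWeightedGrammar T) (w : List T) : ℝ :=
  if h : ∃ d : G.ParseTree, d.yield = w then G.forestWeight h.choose else 0

theorem wordWeight_yield {G : RuleWeightedGrammar T} (hG : G.Unambiguous) (d : G.ParseTree)
    (hd : d.yield ∈ G.language) : G.wordWeight d.yield = G.forestWeight d := by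
  have h : ∃ d' : G.ParseTree, d'.yield = d.yield := ⟨d, rfl⟩
  rw [wordWeight, dif_pos h, (hG _ hd).unique h.choose_spec rfl]

/-- The probability of `w` among the generated words of length `n` (for `w` one of these). -/
noncomputable def prob [Finite T] (G : RuleWeightedGrammar T) (n : ℕ) (w : List T) : ℝ :=
  G.wordWeight w / ∑ v ∈ G.wordsOfLength n, G.wordWeight v

end RuleWeightedGrammar

/-! Each rule weight in a parse tree is moved to one leaf. A binary node is charged to the first
letter of its right subtree, which gives a bijection between binary nodes and letters other than the
first; a rule `N → t` is charged to its letter, and a chain of unary rules to whatever ends it,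
binary node or letter. Nonterminals carry the pending charges down and letters record them, so the
weight of a letter is the product of its charges (`prod_symbolWeight`). Chains are recorded as sets
of rules without repetition, so the new alphabet is finite; no word is lost, since a smallest tree
never repeats a rule in a chain (`exists_marked_of_size_le`). The annotations of a tree are
determined from the root down, so erasing them is injective on trees, and unambiguity of `G` passes
to the new grammar (`unmarkTree_eq`). -/

namespace ContextFreeGrammar

variable {T : Type u}

/-! ### Parse forests and derivations -/

namespace ParseForest

variable {g : ContextFreeGrammar T}

theorem derives_yield {s : List (Symbol T g.NT)} (f : g.ParseForest s) :
    g.Derives s (f.yield.map Symbol.terminal) := by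
  induction f with
  | nil => exact Derives.refl _
  | leaf t rest ih => exact ih.append_left [Symbol.terminal t]
  | @node A α h s children rest ihc ihr =>
    have h1 : g.Produces (Symbol.nonterminal A :: s) (α ++ s) :=
      ⟨⟨A, α⟩, h, ContextFreeRule.Rewrites.head s⟩
    have h2 := (ihc.append_right s).trans (ihr.append_left (children.yield.map Symbol.terminal))
    simpa [yield] using h1.trans_derives h2

theorem yield_eq_nil (f : g.ParseForest []) : f.yield = [] := by
  cases f
  rfl

theorem exists_split {u v : List (Symbol T g.NT)} (f : g.ParseForest (u ++ v)) :
    ∃ (a : g.ParseForest u) (b : g.ParseForest v), f.yield = a.yield ++ b.yield := by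
  induction u with
  | nil => exact ⟨.nil, f, rfl⟩
  | cons x u ih =>
    cases f with
    | leaf t rest =>
      obtain ⟨a, b, h⟩ := ih rest
      exact ⟨.leaf t a, b, by simp [yield, h]⟩
    | node A α hr children rest =>
      obtain ⟨a, b, h⟩ := ih rest
      exact ⟨.node A α hr children a, b, by simp [yield, h]⟩

/-- A rewriting step is undone by gathering the trees over the output of the rule under a new node.
Applied backwards along a derivation, this builds a tree from the leaves. -/
theorem exists_of_rewrites {r : ContextFreeRule T g.NT} (hr : r ∈ g.rules)
    {u v : List (Symbol T g.NT)} (h : r.Rewrites u v) (f : g.ParseForest v) :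
    ∃ f' : g.ParseForest u, f'.yield = f.yield := by
  induction h with
  | head s =>
    obtain ⟨a, b, h⟩ := f.exists_split
    exact ⟨.node r.input r.output hr a b, h.symm⟩
  | cons x _ ih =>
    cases f with
    | leaf t rest =>
      obtain ⟨a, h⟩ := ih rest
      exact ⟨.leaf t a, by simp [yield, h]⟩
    | node A α hA children rest =>
      obtain ⟨a, h⟩ := ih rest
      exact ⟨.node A α hA children a, by simp [yield, h]⟩

/-- The forest of leaves of a word. -/
def leaves : (w : List T) → g.ParseForest (w.map Symbol.terminal)
  | [] => .nil
  | t :: w => .leaf t (leaves w)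

theorem yield_leaves (w : List T) : (leaves w : g.ParseForest _).yield = w := by
  induction w with
  | nil => rfl
  | cons t w ih => exact congrArg (t :: ·) ih

theorem exists_of_derives {s : List (Symbol T g.NT)} {w : List T}
    (h : g.Derives s (w.map Symbol.terminal)) : ∃ f : g.ParseForest s, f.yield = w := by
  induction h using Relation.ReflTransGen.head_induction_on with
  | refl => exact ⟨leaves w, yield_leaves w⟩
  | head h _ ih =>
    obtain ⟨r, hr, hrw⟩ := h
    obtain ⟨f, hf⟩ := ih
    obtain ⟨f', hf'⟩ := exists_of_rewrites hr hrw f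
    exact ⟨f', hf'.trans hf⟩

/-- The number of symbols at the nodes of a forest. -/
def size : {s : List (Symbol T g.NT)} → g.ParseForest s → ℕ
  | _, .nil => 0
  | _, .leaf _ rest => rest.size + 1
  | _, .node _ _ _ children rest => children.size + rest.size + 1

/-- A forest of two trees is made of its two trees. -/
theorem exists_pair {x y : Symbol T g.NT} (f : g.ParseForest [x, y]) :
    ∃ (a : g.ParseForest [x]) (b : g.ParseForest [y]),
      f.yield = a.yield ++ b.yield ∧ f.size = a.size + b.size := by
  cases f with
  | leaf t rest => exact ⟨.leaf t .nil, rest, rfl, by simp [size]; omega⟩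
  | node A α h children rest =>
    exact ⟨.node A α h children .nil, rest, by simp [yield], by simp [size]; omega⟩

end ParseForest

theorem mem_language_iff_exists_parseTree {g : ContextFreeGrammar T} {w : List T} :
    w ∈ g.language ↔ ∃ d : g.ParseTree, d.yield = w := by
  refine ⟨fun h => ParseForest.exists_of_derives h, ?_⟩
  rintro ⟨d, rfl⟩
  exact d.derives_yield

end ContextFreeGrammar

/-! ### The annotated grammar -/

namespace RuleWeightedGrammar

open ContextFreeGrammar

variable {T : Type u}

/-- Names of the rules. -/
abbrev RuleIndex (G : RuleWeightedGrammar T) : Type := Fin G.rules.card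

/-- The rule with a given name. -/
noncomputable def rule (G : RuleWeightedGrammar T) (i : G.RuleIndex) :
    {r : ContextFreeRule T G.NT // r ∈ G.rules} := G.rules.equivFin.symm i

/-- A binary rule together with the unary rules in the chain above it, or nothing. -/
abbrev Mark (G : RuleWeightedGrammar T) : Type := Option (G.RuleIndex × Finset G.RuleIndex)

/-- Nonterminals annotated with the mark to be carried by the first letter they produce, and with
the unary rules in the chain that leads to them. -/
abbrev MarkedNT (G : RuleWeightedGrammar T) : Type := G.NT × G.Mark × Finset G.RuleIndex

/-- Letters annotated with a mark, with a chain of unary rules, and with the rule that produces the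
letter. -/
abbrev MarkedLetter [Finite T] (G : RuleWeightedGrammar T) : Type :=
  Fin (Nat.card T) × G.Mark × Finset G.RuleIndex × G.RuleIndex

/-- The right-hand sides of the annotated copies of a rule. -/
inductive IsMarkedOutput [Finite T] (G : RuleWeightedGrammar T) (i : G.RuleIndex) (x : G.Mark)
    (y : Finset G.RuleIndex) : List (Symbol G.MarkedLetter G.MarkedNT) → Prop
  | empty (h : (G.rule i).1.output = []) : IsMarkedOutput G i x y []
  | letter (t : T) (h : (G.rule i).1.output = [Symbol.terminal t]) :
      IsMarkedOutput G i x y [Symbol.terminal (Finite.equivFin T t, x, y, i)]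
  | unary (B : G.NT) (h : (G.rule i).1.output = [Symbol.nonterminal B]) (hi : i ∉ y) :
      IsMarkedOutput G i x y [Symbol.nonterminal (B, x, insert i y)]
  | binary (B C : G.NT)
      (h : (G.rule i).1.output = [Symbol.nonterminal B, Symbol.nonterminal C]) :
      IsMarkedOutput G i x y
        [Symbol.nonterminal (B, x, ∅), Symbol.nonterminal (C, some (i, y), ∅)]

theorem rule_equivFin (G : RuleWeightedGrammar T) (r : {r // r ∈ G.rules}) :
    G.rule (G.rules.equivFin r) = r := by
  simp [rule]

theorem rule_injective (G : RuleWeightedGrammar T) : Function.Injective G.rule :=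
  G.rules.equivFin.symm.injective

/-- The product of the weights of a set of rules. -/
noncomputable def chainWeight (G : RuleWeightedGrammar T) (y : Finset G.RuleIndex) : ℝ :=
  ∏ i ∈ y, G.weight (G.rule i)

/-- The product of the weights of the rules recorded in a mark. -/
noncomputable def markWeight (G : RuleWeightedGrammar T) : G.Mark → ℝ
  | none => 1
  | some (i, y) => G.weight (G.rule i) * G.chainWeight y

theorem chainWeight_pos (G : RuleWeightedGrammar T) (y : Finset G.RuleIndex) :
    0 < G.chainWeight y :=
  Finset.prod_pos fun _ _ => G.weight_pos _

theorem markWeight_pos (G : RuleWeightedGrammar T) : ∀ x : G.Mark, 0 < G.markWeight x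
  | none => one_pos
  | some (_, y) => mul_pos (G.weight_pos _) (G.chainWeight_pos y)

theorem forestWeight_pos (G : RuleWeightedGrammar T) {s : List (Symbol T G.NT)}
    (f : G.ParseForest s) : 0 < G.forestWeight f := by
  induction f with
  | nil => exact one_pos
  | leaf t rest ih => exact ih
  | node A α h children rest ihc ihr => exact mul_pos (mul_pos (G.weight_pos _) ihc) ihr

variable [Finite T]

theorem IsMarkedOutput.unique {G : RuleWeightedGrammar T} {i : G.RuleIndex} {x : G.Mark}
    {y : Finset G.RuleIndex} {α β : List (Symbol G.MarkedLetter G.MarkedNT)}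
    (hα : G.IsMarkedOutput i x y α) (hβ : G.IsMarkedOutput i x y β) : α = β := by
  cases hα <;> cases hβ <;> simp_all

/-- A rule and an annotated left-hand side leave at most one right-hand side, and there are finitely
many such pairs. -/
theorem finite_markedRules (G : RuleWeightedGrammar T) :
    {r : ContextFreeRule G.MarkedLetter G.MarkedNT | ∃ i : G.RuleIndex,
      (G.rule i).1.input = r.input.1 ∧ G.IsMarkedOutput i r.input.2.1 r.input.2.2 r.output}.Finite
    := by
  have := G.finite_NT
  refine (Set.finite_iUnion (ι := G.RuleIndex × G.MarkedNT)
    (f := fun p => {r | r.input = p.2 ∧ G.IsMarkedOutput p.1 p.2.2.1 p.2.2.2 r.output})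
    fun p => Set.Subsingleton.finite ?_).subset ?_
  · rintro r ⟨hr, hr'⟩ s ⟨hs, hs'⟩
    exact ContextFreeRule.ext (hr.trans hs.symm) (hr'.unique hs')
  · rintro r ⟨i, -, hi⟩
    exact Set.mem_iUnion.2 ⟨(i, r.input), rfl, hi⟩

/-- The grammar of the annotated words, with weights on the letters. -/
noncomputable abbrev marked (G : RuleWeightedGrammar T) :
    TerminalWeightedGrammar G.MarkedLetter where
  NT := G.MarkedNT
  initial := (G.initial, none, ∅)
  rules := G.finite_markedRules.toFinset
  finite_NT := by
    have := G.finite_NT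
    infer_instance
  weight t := G.markWeight t.2.1 * G.chainWeight t.2.2.1 * G.weight (G.rule t.2.2.2)
  weight_pos t := mul_pos (mul_pos (G.markWeight_pos _) (G.chainWeight_pos _)) (G.weight_pos _)

theorem mem_marked_rules {G : RuleWeightedGrammar T} {A : G.MarkedNT}
    {α : List (Symbol G.MarkedLetter G.MarkedNT)} :
    (⟨A, α⟩ : ContextFreeRule G.MarkedLetter G.MarkedNT) ∈ G.marked.rules ↔
      ∃ i : G.RuleIndex, (G.rule i).1.input = A.1 ∧ G.IsMarkedOutput i A.2.1 A.2.2 α :=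
  Set.Finite.mem_toFinset _

/-! ### Erasing the annotations -/

/-- The letter of which an annotated letter is a copy. -/
noncomputable def unmark (G : RuleWeightedGrammar T) (t : G.MarkedLetter) : T :=
  (Finite.equivFin T).symm t.1

/-- The symbol of which an annotated symbol is a copy. -/
noncomputable def unmarkSymbol (G : RuleWeightedGrammar T) :
    Symbol G.MarkedLetter G.MarkedNT → Symbol T G.NT
  | .terminal t => .terminal (G.unmark t)
  | .nonterminal A => .nonterminal A.1

theorem IsMarkedOutput.map_unmarkSymbol {G : RuleWeightedGrammar T} {i : G.RuleIndex}
    {x : G.Mark} {y : Finset G.RuleIndex} {α : List (Symbol G.MarkedLetter G.MarkedNT)}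
    (h : G.IsMarkedOutput i x y α) : α.map G.unmarkSymbol = (G.rule i).1.output := by
  cases h <;> simp [unmarkSymbol, unmark, *]

theorem unmarkSymbol_mem_rules {G : RuleWeightedGrammar T} {A : G.MarkedNT}
    {α : List (Symbol G.MarkedLetter G.MarkedNT)}
    (h : (⟨A, α⟩ : ContextFreeRule G.MarkedLetter G.MarkedNT) ∈ G.marked.rules) :
    ⟨A.1, α.map G.unmarkSymbol⟩ ∈ G.rules := by
  obtain ⟨i, hi, hα⟩ := mem_marked_rules.1 h
  rw [← hi, hα.map_unmarkSymbol]
  exact (G.rule i).2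

/-- The forest obtained by removing the annotations. -/
noncomputable def unmarkForest (G : RuleWeightedGrammar T) :
    {s : List (Symbol G.MarkedLetter G.marked.NT)} → G.marked.ParseForest s →
      G.ParseForest (s.map G.unmarkSymbol)
  | _, .nil => .nil
  | _, .leaf t rest => .leaf (G.unmark t) (G.unmarkForest rest)
  | _, .node A _ h children rest =>
      .node A.1 _ (unmarkSymbol_mem_rules h) (G.unmarkForest children) (G.unmarkForest rest)

theorem yield_unmarkForest {G : RuleWeightedGrammar T}
    {s : List (Symbol G.MarkedLetter G.marked.NT)} (f : G.marked.ParseForest s) :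
    (G.unmarkForest f).yield = f.yield.map G.unmark := by
  induction f with
  | nil => rfl
  | leaf t rest ih => exact congrArg (G.unmark t :: ·) ih
  | node A α h children rest ihc ihr =>
    simp only [unmarkForest, ParseForest.yield, List.map_append, ← ihc, ← ihr]

/-- The erased rule identifies the index `i`, and `i` with the annotations of `A` fixes those of the
output. -/
theorem marked_output_unique {G : RuleWeightedGrammar T} {A : G.MarkedNT}
    {α β : List (Symbol G.MarkedLetter G.MarkedNT)}
    (hα : (⟨A, α⟩ : ContextFreeRule G.MarkedLetter G.MarkedNT) ∈ G.marked.rules)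
    (hβ : (⟨A, β⟩ : ContextFreeRule G.MarkedLetter G.MarkedNT) ∈ G.marked.rules)
    (h : α.map G.unmarkSymbol = β.map G.unmarkSymbol) : α = β := by
  obtain ⟨i, hi, hα⟩ := mem_marked_rules.1 hα
  obtain ⟨j, hj, hβ⟩ := mem_marked_rules.1 hβ
  rw [hα.map_unmarkSymbol, hβ.map_unmarkSymbol] at h
  obtain rfl : i = j :=
    G.rule_injective (Subtype.ext (ContextFreeRule.ext (hi.trans hj.symm) h))
  exact hα.unique hβ

theorem unmarkForest_injective {G : RuleWeightedGrammar T}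
    {s : List (Symbol G.MarkedLetter G.marked.NT)} (f f' : G.marked.ParseForest s)
    (h : G.unmarkForest f = G.unmarkForest f') : f = f' := by
  induction f with
  | nil =>
    cases f'
    rfl
  | leaf t rest ih =>
    cases f' with
    | leaf _ rest' =>
      injection h with _ _ h
      rw [ih rest' h]
  | node A α hA children rest ihc ihr =>
    cases f' with
    | node _ α' hA' children' rest' =>
      injection h with _ hα _ hc hr
      obtain rfl := marked_output_unique hA hA' hα
      rw [ihc children' (eq_of_heq hc), ihr rest' hr]

/-! ### Conservation of the weight -/

/-- The weight that the rules recorded in a symbol contribute to the letters produced by it. -/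
noncomputable def symbolWeight (G : RuleWeightedGrammar T) :
    Symbol G.MarkedLetter G.MarkedNT → ℝ
  | .terminal t => G.marked.weight t
  | .nonterminal A => G.markWeight A.2.1 * G.chainWeight A.2.2

/-- Applying a rule adds its weight to the pending charges and loses none, except for an empty
output, where no symbol is left to carry them. -/
theorem IsMarkedOutput.prod_symbolWeight {G : RuleWeightedGrammar T} {i : G.RuleIndex}
    {x : G.Mark} {y : Finset G.RuleIndex} {α : List (Symbol G.MarkedLetter G.MarkedNT)}
    (h : G.IsMarkedOutput i x y α) (hα : α ≠ []) :
    (α.map G.symbolWeight).prod = G.weight (G.rule i) * (G.markWeight x * G.chainWeight y) := by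
  cases h with
  | empty => exact absurd rfl hα
  | letter t h => simp [symbolWeight, mul_comm]
  | unary B h hi =>
    simp only [List.map_cons, List.map_nil, List.prod_singleton, symbolWeight, chainWeight,
      Finset.prod_insert hi]
    ring
  | binary B C h =>
    simp only [List.map_cons, List.map_nil, List.prod_cons, List.prod_nil, symbolWeight,
      chainWeight, markWeight, Finset.prod_empty]
    ring

theorem weight_unmark {G : RuleWeightedGrammar T} {i : G.RuleIndex} {A : G.MarkedNT}
    {α : List (Symbol G.MarkedLetter G.MarkedNT)} (hi : (G.rule i).1.input = A.1)
    (hα : G.IsMarkedOutput i A.2.1 A.2.2 α)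
    (h : (⟨A.1, α.map G.unmarkSymbol⟩ : ContextFreeRule T G.NT) ∈ G.rules) :
    G.weight ⟨⟨A.1, α.map G.unmarkSymbol⟩, h⟩ = G.weight (G.rule i) :=
  congrArg G.weight (Subtype.ext (ContextFreeRule.ext hi.symm hα.map_unmarkSymbol))

/-- In a binary normal form, only the axiom has an empty right-hand side, and the axiom occurs at
most alone, as the right-hand side of a rule for the axiom. -/
theorem marked_rule_cases {G : RuleWeightedGrammar T} (hG : G.IsBinaryCNF) {A : G.MarkedNT}
    {i : G.RuleIndex} {α : List (Symbol G.MarkedLetter G.MarkedNT)}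
    (hi : (G.rule i).1.input = A.1) (hα : G.IsMarkedOutput i A.2.1 A.2.2 α) :
    (α ≠ [] ∧ ∀ B : G.MarkedNT, Symbol.nonterminal B ∈ α → B.1 ≠ G.initial) ∨
      A.1 = G.initial ∧ (α = [] ∨ ∃ B : G.MarkedNT, α = [Symbol.nonterminal B]) := by
  have h := hG _ (G.rule i).2
  rw [hi] at h
  cases hα <;> simp_all
  tauto

theorem wordWeight_append {T' : Type*} (H : TerminalWeightedGrammar T') (v w : List T') :
    H.wordWeight (v ++ w) = H.wordWeight v * H.wordWeight w := by
  simp [TerminalWeightedGrammar.wordWeight]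

/-- Away from the axiom no rule erases, so the weight is conserved. The second half treats the
axiom, which may lose its charges through `S → ε`, possibly below steps `S → S`; the word is then
empty. -/
theorem wordWeight_yield_marked {G : RuleWeightedGrammar T} (hG : G.IsBinaryCNF)
    {s : List (Symbol G.MarkedLetter G.marked.NT)} (f : G.marked.ParseForest s) :
    ((∀ B : G.MarkedNT, Symbol.nonterminal B ∈ s → B.1 ≠ G.initial) →
      G.marked.wordWeight f.yield =
        (s.map G.symbolWeight).prod * G.forestWeight (G.unmarkForest f)) ∧
    ((∃ B : G.MarkedNT, s = [Symbol.nonterminal B]) → f.yield = [] ∨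
      G.marked.wordWeight f.yield =
        (s.map G.symbolWeight).prod * G.forestWeight (G.unmarkForest f)) := by
  induction f with
  | nil =>
    exact ⟨fun _ => by
      simp [TerminalWeightedGrammar.wordWeight, ParseForest.yield, unmarkForest, forestWeight],
      by rintro ⟨B, h⟩; cases h⟩
  | @leaf t s rest ih =>
    refine ⟨fun h => ?_, by rintro ⟨B, h⟩; cases h⟩
    have := ih.1 fun B hB => h B (List.mem_cons_of_mem _ hB)
    change G.marked.wordWeight ([t] ++ rest.yield) = _
    rw [wordWeight_append, this]
    simp [TerminalWeightedGrammar.wordWeight, unmarkForest, forestWeight, symbolWeight, mul_assoc]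
  | @node A α h s children rest ihc ihr =>
    obtain ⟨i, hi, hα⟩ := mem_marked_rules.1 h
    have key : α ≠ [] →
        G.marked.wordWeight children.yield =
          (α.map G.symbolWeight).prod * G.forestWeight (G.unmarkForest children) →
        G.marked.wordWeight rest.yield =
          (s.map G.symbolWeight).prod * G.forestWeight (G.unmarkForest rest) →
        G.marked.wordWeight (ParseForest.node A α h children rest).yield =
          ((Symbol.nonterminal A :: s).map G.symbolWeight).prod *
            G.forestWeight (G.unmarkForest (ParseForest.node A α h children rest)) := by
      intro hne h1 h2
      simp only [ParseForest.yield, wordWeight_append, h1, h2, unmarkForest, forestWeight,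
        hα.prod_symbolWeight hne, weight_unmark hi hα, List.map_cons, List.prod_cons, symbolWeight]
      ring
    refine ⟨fun hs => ?_, ?_⟩
    · rcases marked_rule_cases hG hi hα with ⟨h1, h2⟩ | ⟨h1, -⟩
      · exact key h1 (ihc.1 h2) (ihr.1 fun B hB => hs B (List.mem_cons_of_mem _ hB))
      · exact absurd h1 (hs A List.mem_cons_self)
    · rintro ⟨B, hB⟩
      obtain rfl : s = [] := (List.cons.inj hB).2
      have hr := ihr.1 (by simp)
      rcases marked_rule_cases hG hi hα with ⟨h1, h2⟩ | ⟨-, rfl | ⟨C, rfl⟩⟩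
      · exact .inr (key h1 (ihc.1 h2) hr)
      · exact .inl (by simp [ParseForest.yield, ParseForest.yield_eq_nil children,
          ParseForest.yield_eq_nil rest])
      · rcases ihc.2 ⟨C, rfl⟩ with h1 | h1
        · exact .inl (by simp [ParseForest.yield, h1, ParseForest.yield_eq_nil rest])
        · exact .inr (key (by simp) h1 hr)

/-! ### Every word has an annotated tree -/

/-- Every derivable word is the relabelling of a word derivable in the marked grammar. The bound on
the size ensures that no unary rule is used twice in a chain. -/
theorem exists_marked_of_size_le {G : RuleWeightedGrammar T} (hG : G.IsBinaryCNF) (n : ℕ) :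
    ∀ (A : G.NT) (w : List T) (x : G.Mark) (y : Finset G.RuleIndex),
      (∃ f : G.ParseForest [Symbol.nonterminal A], f.yield = w ∧ f.size ≤ n) →
      (∀ i ∈ y, ∀ f : G.ParseForest [Symbol.nonterminal (G.rule i).1.input],
        f.yield = w → n < f.size) →
      ∃ f : G.marked.ParseForest [Symbol.nonterminal ((A, x, y) : G.MarkedNT)],
        f.yield.map G.unmark = w := by
  induction n with
  | zero =>
    rintro A w x y ⟨f, -, hf⟩
    cases f
    simp [ParseForest.size] at hf
  | succ n ih =>
    intro A w x y hA hy
    -- Passing to a smaller tree whenever there is one makes the remaining tree of minimal size for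
    -- `A` and `w`.
    by_cases hA' : ∃ f : G.ParseForest [Symbol.nonterminal A], f.yield = w ∧ f.size ≤ n
    · exact ih A w x y hA' fun i hi f hf => (Nat.lt_succ_self n).trans (hy i hi f hf)
    obtain ⟨f, rfl, hn⟩ := hA
    have hmin : ∀ f' : G.ParseForest [Symbol.nonterminal A], f'.yield = f.yield → n < f'.size :=
      fun f' hf' => not_le.1 fun hle => hA' ⟨f', hf', hle⟩
    cases f with
    | node _ α h c rest =>
    cases rest
    have hc : c.size ≤ n := by simpa [ParseForest.size] using hn
    simp only [ParseForest.yield, List.append_nil] at hmin hy ⊢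
    obtain ⟨i, hi⟩ : ∃ i, G.rule i = ⟨⟨A, α⟩, h⟩ := ⟨_, G.rule_equivFin _⟩
    have build : ∀ (β : List (Symbol G.MarkedLetter G.MarkedNT)), G.IsMarkedOutput i x y β →
        ∀ f : G.marked.ParseForest β, ∃ f' : G.marked.ParseForest
          [Symbol.nonterminal ((A, x, y) : G.MarkedNT)], f'.yield = f.yield := fun β hβ f =>
      ⟨.node _ β (mem_marked_rules.2 ⟨i, by rw [hi], hβ⟩) f .nil, by simp [ParseForest.yield]⟩
    have hout : (G.rule i).1.output = α := by rw [hi]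
    have hunary : ∀ B : G.NT, α = [Symbol.nonterminal B] →
        ∃ f : G.marked.ParseForest [Symbol.nonterminal ((A, x, y) : G.MarkedNT)],
          f.yield.map G.unmark = c.yield := by
      rintro B rfl
      -- Were `i` already in the chain, the present tree would be too small for `hy`.
      have hiy : i ∉ y := fun hmem => by
        have := hy i hmem
        rw [hi] at this
        exact absurd (this (.node A _ h c .nil) (by simp [ParseForest.yield])) (by
          simpa using hn)
      obtain ⟨f, hf⟩ := ih B c.yield x (insert i y) ⟨c, rfl, hc⟩ (by
        intro j hj
        -- For the newly recorded rule, the size condition is the minimality of the present tree.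
        rcases Finset.mem_insert.1 hj with rfl | hj
        · rw [hi]
          exact hmin
        · exact fun f hf => (Nat.lt_succ_self n).trans (hy j hj f hf))
      obtain ⟨f', hf'⟩ := build _ (.unary B hout hiy) f
      exact ⟨f', by rw [hf', hf]⟩
    rcases hG _ h with ⟨-, rfl⟩ | ⟨-, B, hα⟩ | ⟨-, B, -, hα⟩ | ⟨-, B, C, -, -, rfl⟩ | ⟨t, rfl⟩
    · cases c
      obtain ⟨f', hf'⟩ := build _ (.empty hout) .nil
      exact ⟨f', by rw [hf']; rfl⟩
    · exact hunary B hα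
    · exact hunary B hα
    · obtain ⟨a, b, hab, hsize⟩ := c.exists_pair
      obtain ⟨a', ha'⟩ := ih B a.yield x ∅ ⟨a, rfl, by omega⟩ (by simp)
      obtain ⟨b', hb'⟩ := ih C b.yield (some (i, y)) ∅ ⟨b, rfl, by omega⟩ (by simp)
      -- The root of `a'` is detached so that `b'` can become its right sibling in one forest.
      cases a' with
      | node _ _ hB ca ra =>
      cases ra
      obtain ⟨f', hf'⟩ := build _ (.binary B C hout) (.node _ _ hB ca b')
      refine ⟨f', ?_⟩
      simp only [ParseForest.yield, List.append_nil] at ha'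
      rw [hf', hab, ← ha', ← hb']
      simp [ParseForest.yield]
    · cases c with
      | leaf _ rest =>
      cases rest
      obtain ⟨f', hf'⟩ := build _ (.letter t hout) (.leaf _ .nil)
      exact ⟨f', by rw [hf']; simp [ParseForest.yield, unmark]⟩

/-! ### Unambiguity, bijection and probabilities -/

theorem unmarkTree_eq {G : RuleWeightedGrammar T} (hG : G.Unambiguous) {d d' : G.marked.ParseTree}
    (h : d.yield.map G.unmark = d'.yield.map G.unmark) : d = d' := by
  refine unmarkForest_injective d d' ((hG (d.yield.map G.unmark) ?_).unique
    (yield_unmarkForest d) ((yield_unmarkForest d').trans h.symm))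
  exact mem_language_iff_exists_parseTree.2 ⟨G.unmarkForest d, yield_unmarkForest d⟩

theorem marked_unambiguous {G : RuleWeightedGrammar T} (hG : G.Unambiguous) :
    G.marked.Unambiguous := by
  intro w hw
  obtain ⟨d, rfl⟩ := mem_language_iff_exists_parseTree.1 hw
  exact ⟨d, rfl, fun d' hd' => unmarkTree_eq hG (congrArg _ hd')⟩

theorem bijOn_unmark {G : RuleWeightedGrammar T} (hG : G.Unambiguous) (hcnf : G.IsBinaryCNF) :
    Set.BijOn (List.map G.unmark) G.marked.language G.language := by
  refine ⟨fun w hw => ?_, fun v hv w hw h => ?_, fun w hw => ?_⟩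
  · obtain ⟨d, rfl⟩ := mem_language_iff_exists_parseTree.1 hw
    exact mem_language_iff_exists_parseTree.2 ⟨G.unmarkForest d, yield_unmarkForest d⟩
  · obtain ⟨d, rfl⟩ := mem_language_iff_exists_parseTree.1 hv
    obtain ⟨d', rfl⟩ := mem_language_iff_exists_parseTree.1 hw
    rw [unmarkTree_eq hG h]
  · obtain ⟨d, rfl⟩ := mem_language_iff_exists_parseTree.1 hw
    obtain ⟨f, hf⟩ := exists_marked_of_size_le hcnf d.size G.initial d.yield none ∅
      ⟨d, rfl, le_rfl⟩ (by simp)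
    exact ⟨f.yield, mem_language_iff_exists_parseTree.2 ⟨f, rfl⟩, hf⟩

/-- The annotated axiom has no pending charge, so conservation becomes equality of weights. The
empty word is excluded: it has weight `1` in `G.marked`, whatever the weights of the rules. -/
theorem wordWeight_marked {G : RuleWeightedGrammar T} (hG : G.Unambiguous) (hcnf : G.IsBinaryCNF)
    {w : List G.MarkedLetter} (hw : w ∈ G.marked.language) (hne : w ≠ []) :
    G.marked.wordWeight w = G.wordWeight (w.map G.unmark) := by
  have hmem : w.map G.unmark ∈ G.language := (bijOn_unmark hG hcnf).mapsTo hw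
  obtain ⟨d, rfl⟩ := mem_language_iff_exists_parseTree.1 hw
  rw [← yield_unmarkForest] at hmem ⊢
  rw [((wordWeight_yield_marked hcnf d).2 ⟨_, rfl⟩).resolve_left hne]
  refine Eq.trans ?_ (wordWeight_yield hG (G.unmarkForest d) hmem).symm
  simp [symbolWeight, markWeight, chainWeight]
  rfl

theorem prob_marked {G : RuleWeightedGrammar T} (hG : G.Unambiguous) (hcnf : G.IsBinaryCNF)
    (n : ℕ) {w : List G.MarkedLetter} (hw : w ∈ G.marked.wordsOfLength n) :
    G.marked.prob n w = G.prob n (w.map G.unmark) := by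
  have hbij := bijOn_unmark hG hcnf
  obtain ⟨hwl, rfl⟩ := mem_wordsOfLength.1 hw
  have hsum : ∑ v ∈ G.wordsOfLength w.length, G.wordWeight v =
      ∑ v ∈ G.marked.wordsOfLength w.length, G.wordWeight (v.map G.unmark) := by
    refine (Finset.sum_bij (fun v _ => v.map G.unmark) (fun v hv => ?_) (fun v hv v' hv' h => ?_)
      (fun v hv => ?_) fun _ _ => rfl).symm
    · rw [mem_wordsOfLength] at hv ⊢
      exact ⟨hbij.mapsTo hv.1, by simpa using hv.2⟩
    · exact hbij.injOn (mem_wordsOfLength.1 hv).1 (mem_wordsOfLength.1 hv').1 h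
    · obtain ⟨hv, hlen⟩ := mem_wordsOfLength.1 hv
      obtain ⟨v', hv', rfl⟩ := hbij.surjOn hv
      exact ⟨v', mem_wordsOfLength.2 ⟨hv', by simpa using hlen⟩, rfl⟩
  rw [TerminalWeightedGrammar.prob, prob, hsum]
  rcases eq_or_ne w [] with rfl | hne
  -- In length `0` the weights may differ, but the only word has probability `1` on both sides.
  · have hone : G.marked.wordsOfLength ([] : List G.MarkedLetter).length = {[]} := by
      ext v
      rw [mem_wordsOfLength, Finset.mem_singleton, List.length_nil, List.length_eq_zero_iff]
      exact ⟨And.right, by rintro rfl; exact ⟨hwl, rfl⟩⟩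
    obtain ⟨d, hd⟩ := mem_language_iff_exists_parseTree.1 (hbij.mapsTo hwl)
    have hpos : G.wordWeight ([].map G.unmark) ≠ 0 := by
      rw [← hd, wordWeight_yield hG d (hd ▸ hbij.mapsTo hwl)]
      exact (G.forestWeight_pos d).ne'
    rw [hone, Finset.sum_singleton, Finset.sum_singleton, div_self hpos]
    simp [TerminalWeightedGrammar.wordWeight]
  · rw [wordWeight_marked hG hcnf hwl hne]
    congr 1
    refine Finset.sum_congr rfl fun v hv => ?_
    obtain ⟨hv, hlen⟩ := mem_wordsOfLength.1 hv
    refine wordWeight_marked hG hcnf hv fun h => hne ?_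
    rwa [h, List.length_nil, eq_comm, List.length_eq_zero_iff] at hlen

end RuleWeightedGrammar

theorem mainTheorem1 {T : Type u} [Finite T] (G : RuleWeightedGrammar T)
    (hunamb : G.Unambiguous) (hcnf : G.IsBinaryCNF) :
    ∃ (T' : Type) (_ : Finite T') (relabel : T' → T) (H : TerminalWeightedGrammar T'),
      H.Unambiguous ∧
      Set.BijOn (List.map relabel) H.language G.language ∧
      ∀ (n : ℕ), ∀ w ∈ H.wordsOfLength n, H.prob n w = G.prob n (w.map relabel) :=
  ⟨G.MarkedLetter, inferInstance, G.unmark, G.marked, RuleWeightedGrammar.marked_unambiguous hunamb,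
    RuleWeightedGrammar.bijOn_unmark hunamb hcnf,
    fun n _ hw => RuleWeightedGrammar.prob_marked hunamb hcnf n hw⟩
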